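/- Consider the downlink of an OFDMA system with $L$ sub-carriers, in which a single-antenna base station serves $K$ single-antenna users with the help of a reconfigurable surface of $N$ passive reflecting elements. In a time-slot, the channel of user $k$ on sub-carrier $l$ is $$h_k^{(l)}=\sqrt{\rho_R^{(l)}}\,\mathbf h_1^{(l)}\boldsymbol\Theta\,\mathbf h_{2,k}^{(l)}+\sqrt{\rho_B^{(l)}}\,h_{d,k}^{(l)},\qquad \boldsymbol\Theta=\beta\,\mathrm{diag}(e^{j\theta_1},\dots,e^{j\theta_N}),$$ where $\beta\ge 0$ is the reflection amplitude, $\rho_R^{(l)},\rho_B^{(l)}\ge 0$ are the average SNRs (the same for all users), and $\mathbf h_1^{(l)}$ is the fixed row vector with entries $e^{j2\pi(n-1)d^{(l)}\sin\vartheta^{(l)}_n}$ for real $d^{(l)},\vartheta_n^{(l)}$, $n=1,\dots,N$. The phases $\theta_1,\dots,\theta_N$, common to all users and sub-carriers, are independent and uniform on $[0,2\pi]$. On every sub-carrier the fading is independent Rician: with factors $\kappa^{(l)},\kappa_B^{(l)}\ge 0$, $$h_{2,k,n}^{(l)}=\sqrt{\tfrac{\kappa^{(l)}}{1+\kappa^{(l)}}}\,e^{j\phi^{(l)}_{k,n}}+b^{(l)}_{k,n},\qquad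 h_{d,k}^{(l)}=\sqrt{\tfrac{\kappa_B^{(l)}}{1+\kappa_B^{(l)}}}\,e^{j\psi^{(l)}_{k}}+b^{(l)}_{d,k},$$ where, for each fixed $l$, all the $\phi^{(l)}_{k,n},\psi^{(l)}_k$ (uniform on $[0,2\pi]$), $b^{(l)}_{k,n}\sim\mathcal{CN}\big(0,\tfrac1{1+\kappa^{(l)}}\big)$, $b^{(l)}_{d,k}\sim\mathcal{CN}\big(0,\tfrac1{1+\kappa_B^{(l)}}\big)$ and $\theta_n$ are mutually independent (no assumption is made on the dependence between different sub-carriers). Each sub-carrier is assigned to the user with the largest SNR $|h_k^{(l)}|^2$, so that the sum-capacity is $$R^{(K)}=\mathbb E\Big[\sum_{l=1}^L\log_2\Big(1+\max_{1\le k\le K}|h_k^{(l)}|^2\Big)\Big].$$ Put $$\xi^{(l)}(K)=\left(\sqrt{\left(\frac{\rho_R^{(l)} N\beta^2}{1+\kappa^{(l)}}+\frac{\rho_B^{(l)}}{1+\kappa_B^{(l)}}\right)\log K}+N\beta\sqrt{\frac{\rho_R^{(l)}\kappa^{(l)}}{1+\kappa^{(l)}}}+\sqrt{\frac{\rho_B^{(l)}\kappa_B^{(l)}}{1+\kappa_B^{(l)}}}\right)^2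 .$$ Then, for all fixed values of the parameters, the rates are integrable and, as $K\to\infty$, $$R^{(K)}=\sum_{l=1}^L\log_2\Big(1+\xi^{(l)}(K)+O(\log\log K)\Big);$$ that is, there are sequences $e_l(K)=O(\log\log K)$, $l=1,\dots,L$, such that for every $K\ge 1$ all the numbers $1+\xi^{(l)}(K)+e_l(K)$ are positive and $R^{(K)}=\sum_{l=1}^L\log_2(1+\xi^{(l)}(K)+e_l(K))$. -/

import Mathlib

open MeasureTheory ProbabilityTheory Filter Asymptotics

noncomputable section

namespace RSOBF

/-- The uniform law on the phase interval `[0, 2π]`. -/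
def phaseLaw : Measure ℝ := cond volume (Set.Icc (0 : ℝ) (2 * Real.pi))

/-- The circularly symmetric complex Gaussian law `CN(0, u)` for `0 ≤ u`: real and imaginary part
are independent centred real Gaussians of variance `u / 2`. -/
def complexNormal (u : ℝ) : Measure ℂ :=
  ((gaussianReal 0 (u / 2).toNNReal).prod (gaussianReal 0 (u / 2).toNNReal)).map
    Complex.measurableEquivRealProd.symm

/-- The sources of randomness in the channels of one user on one sub-channel. -/
structure UserFading (N : ℕ) where
  /-- phases of the line-of-sight components from the `N` surface elements to the user -/
  losPhase : Fin N → ℝ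
  /-- scattered components from the `N` surface elements to the user -/
  scatter : Fin N → ℂ
  /-- phase of the line-of-sight component from the base station to the user -/
  directPhase : ℝ
  /-- scattered component from the base station to the user -/
  directScatter : ℂ

/-- The fading sources of a user, as a tuple. -/
def UserFading.toTuple {N : ℕ} (x : UserFading N) : (Fin N → ℝ) × (Fin N → ℂ) × ℝ × ℂ :=
  (x.losPhase, x.scatter, x.directPhase, x.directScatter)

/-- The law of the fading sources of a user: all components are independent, the line-of-sight
phases are uniform, the scattered components are `CN(0, 1/(1+κ))` on the surface-to-user links and
`CN(0, 1/(1+κB))` on the direct link. -/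
def userLaw (N : ℕ) (κ κB : ℝ) : Measure ((Fin N → ℝ) × (Fin N → ℂ) × ℝ × ℂ) :=
  (Measure.pi fun _ => phaseLaw).prod
    ((Measure.pi fun _ => complexNormal (1 / (1 + κ))).prod
      (phaseLaw.prod (complexNormal (1 / (1 + κB)))))

/-- Independent Rician fading on one sub-channel, for users `k = 0, 1, 2, …`, together with
independent uniform phase shifts `θ` of the `N` surface elements: the users' fading sources are
i.i.d. with law `userLaw`, and they are independent of `θ`. -/
structure IndependentRicianFading {Ω : Type*} [MeasurableSpace Ω] (P : Measure Ω) {N : ℕ}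
    (κ κB : ℝ) (θ : Ω → Fin N → ℝ) (X : ℕ → Ω → UserFading N) : Prop where
  phase_law : HasLaw θ (Measure.pi fun _ => phaseLaw) P
  user_law : ∀ k, HasLaw (fun ω => (X k ω).toTuple) (userLaw N κ κB) P
  users_indep : iIndepFun (fun k ω => (X k ω).toTuple) P
  phase_indep : IndepFun θ (fun ω k => (X k ω).toTuple) P

/-- The surface-to-user channel vector `√(κ/(1+κ)) e^{jφ} + b`. -/
def h2 {N : ℕ} (κ : ℝ) (x : UserFading N) : Fin N → ℂ := fun n =>
  (√(κ / (1 + κ)) : ℂ) * Complex.exp (Complex.I * x.losPhase n) + x.scatter n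

/-- The direct channel `√(κB/(1+κB)) e^{jψ} + b_d` from the base station to the user. -/
def hd {N : ℕ} (κB : ℝ) (x : UserFading N) : ℂ :=
  (√(κB / (1 + κB)) : ℂ) * Complex.exp (Complex.I * x.directPhase) + x.directScatter

/-- The static line-of-sight channel from the base station to the surface, with entries
`e^{j 2π (n-1) d sin ϑ_n}`, `n = 1, …, N` (here `n` is counted from `0`). -/
def h1 {N : ℕ} (d : ℝ) (ϑ : Fin N → ℝ) : Fin N → ℂ := fun n =>
  Complex.exp (Complex.I * ((2 * Real.pi * (n : ℕ) * d * Real.sin (ϑ n) : ℝ) : ℂ))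

/-- The response `β diag(e^{jθ_1}, …, e^{jθ_N})` of the surface. -/
def surfaceResponse {N : ℕ} (β : ℝ) (θ : Fin N → ℝ) : Matrix (Fin N) (Fin N) ℂ :=
  (β : ℂ) • Matrix.diagonal fun n => Complex.exp (Complex.I * θ n)

/-- The deterministic parameters of one sub-channel. -/
structure Subchannel (N : ℕ) where
  /-- average SNR of the link through the surface -/
  ρR : ℝ
  /-- average SNR of the direct link -/
  ρB : ℝ
  /-- ratio of line-of-sight to scattered energy, surface-to-user links -/
  κ : ℝ
  /-- ratio of line-of-sight to scattered energy, direct links -/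
  κB : ℝ
  /-- normalized spacing of the surface elements -/
  d : ℝ
  /-- line-of-sight angles from the base station to the surface elements -/
  ϑ : Fin N → ℝ

/-- The overall channel `√ρR h₁ Θ h₂ + √ρB h_d` of a user on a sub-channel. -/
def channel {N : ℕ} (β : ℝ) (c : Subchannel N) (θ : Fin N → ℝ) (x : UserFading N) : ℂ :=
  (√c.ρR : ℂ) * (h1 c.d c.ϑ ⬝ᵥ Matrix.mulVec (surfaceResponse β θ) (h2 c.κ x)) +
    (√c.ρB : ℂ) * hd c.κB x

/-- The SNR `γ = |h|²` of a user on a sub-channel. -/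
def snr {N : ℕ} (β : ℝ) (c : Subchannel N) (θ : Fin N → ℝ) (x : UserFading N) : ℝ :=
  ‖channel β c θ x‖ ^ 2

/-- The instantaneous rate `log₂(1 + max_k γ_k)` of a sub-channel that is assigned to the best of
the first `K` users (`K ≥ 1`). -/
def bestUserRate {N : ℕ} (β : ℝ) (c : Subchannel N) (K : ℕ) (θ : Fin N → ℝ)
    (x : ℕ → UserFading N) : ℝ :=
  Real.logb 2 (1 + ⨆ k : Fin K, snr β c θ (x k))

/-- The sum-capacity `R^{(K)}` of the OFDMA system with `K` users: the expectation of the total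
rate over all sub-channels, each one being assigned to its best user. -/
def sumCapacity {Ω : Type*} [MeasurableSpace Ω] (P : Measure Ω) {L N : ℕ} (β : ℝ)
    (c : Fin L → Subchannel N) (θ : Ω → Fin N → ℝ) (X : Fin L → ℕ → Ω → UserFading N)
    (K : ℕ) : ℝ :=
  ∫ ω, ∑ l, bestUserRate β (c l) K (θ ω) (fun k => X l k ω) ∂P

/-- The growth rate `ξ` of the best user's SNR on a sub-channel. -/
def ξ {N : ℕ} (β : ℝ) (c : Subchannel N) (K : ℕ) : ℝ :=
  (√((c.ρR * N * β ^ 2 / (1 + c.κ) + c.ρB / (1 + c.κB)) * Real.log K) +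
    N * β * √(c.ρR * c.κ / (1 + c.κ)) + √(c.ρB * c.κB / (1 + c.κB))) ^ 2

end RSOBF

end

noncomputable section

namespace RSOBF

/-! ### Gaussian and phase estimates. -/

section

/-! Write x = log K, and for one sub-carrier let v be the scattered variance and A the coherent
line-of-sight amplitude, so that ξ = (√(v x) + A)². Define the error as 2^(mean rate) - 1 - ξ. The
required identity and the positivity are then automatic, and linearity of expectation separates the
sub-carriers whatever their dependence. What remains is to bound this error by O(log x) on each
side.

Each channel is a line-of-sight part of modulus at most A plus a scattered part whose coefficients
have moduli not depending on the surface phases; so the scattered part is CN(0, v).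

Upper bound (`integral_bestUserRate_le`): the scattered power divided by v has exponential moment
1/(1-l) of order l < 1. Tangent-line inequalities dominate the rate by an affine function of the sum
of the users' exponentials, chosen so that its mean is exactly log₂(1 + (√(v τ/l) + A)²), with τ =
log(K/(1-l)). Only the marginal laws enter. Taking l = 1 - 1/x gives τ/l = x + O(log x).

Lower bound (`le_integral_bestUserRate`): for any fixed surface phases the users are independent. A
user is strong if its line-of-sight phases are nearly aligned and its scattered part has a large
real part. Alignment costs only a power of x in probability, which is paid for by lowering the
Gaussian level from v x to v (x - O(log x)). Some user then exceeds a level r with r² ≥ ξ - O(log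
x), except with probability at most 1/K.

If v = 0, the channel and ξ both vanish. -/

instance isProbabilityMeasure_phaseLaw : IsProbabilityMeasure phaseLaw := by
  apply cond_isProbabilityMeasure_of_finite
  · simp [Real.pi_pos]
  · simp [ENNReal.mul_eq_top]

instance isProbabilityMeasure_complexNormal (u : ℝ) : IsProbabilityMeasure (complexNormal u) :=
  Measure.isProbabilityMeasure_map (by fun_prop)

instance isProbabilityMeasure_userLaw (N : ℕ) (κ κB : ℝ) :
    IsProbabilityMeasure (userLaw N κ κB) := by
  unfold userLaw; infer_instance

/-- Product of two real Gaussian characteristic functions. The case `u = 0` (a point mass) is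
included, since the variances of linear combinations may vanish. -/
theorem charFun_complexNormal {u : ℝ} (hu : 0 ≤ u) (z : ℂ) :
    charFun (complexNormal u) z = Complex.exp (-(u * ‖z‖ ^ 2 / 4 : ℝ)) := by
  rw [charFun_apply, complexNormal, integral_map (by fun_prop) (by fun_prop)]
  have h : ∀ x : ℝ × ℝ, Complex.exp
      ((inner ℝ (Complex.measurableEquivRealProd.symm x) z : ℝ) * Complex.I) =
      Complex.exp (z.re * x.1 * Complex.I) * Complex.exp (z.im * x.2 * Complex.I) := by
    intro x
    rw [← Complex.exp_add]
    congr 1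
    simp only [Complex.inner, Complex.measurableEquivRealProd_symm_apply, Complex.mul_re,
      Complex.conj_re, Complex.conj_im]
    push_cast
    ring
  simp_rw [h]
  rw [integral_prod_mul (fun x : ℝ => Complex.exp (z.re * x * Complex.I))
    (fun x : ℝ => Complex.exp (z.im * x * Complex.I)), ← charFun_apply_real, ← charFun_apply_real,
    charFun_gaussianReal, charFun_gaussianReal, ← Complex.exp_add,
    ← Complex.normSq_eq_norm_sq, Complex.normSq_apply]
  congr 1
  have hu' : (((u / 2).toNNReal : ℝ) : ℂ) = (u / 2 : ℂ) := by
    rw [Real.coe_toNNReal _ (by positivity)]; push_cast; rfl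
  rw [hu']
  push_cast
  ring

/-- Linear combinations of independent circularly symmetric complex Gaussians are again of this
type. -/
theorem map_linearCombination_complexNormal {N : ℕ} {u v : ℝ} (hu : 0 ≤ u) (hv : 0 ≤ v)
    (a : Fin N → ℂ) (b : ℂ) :
    ((Measure.pi fun _ : Fin N => complexNormal u).prod (complexNormal v)).map
      (fun p => ∑ n, a n * p.1 n + b * p.2) =
      complexNormal ((∑ n, ‖a n‖ ^ 2) * u + ‖b‖ ^ 2 * v) := by
  have hm : Measurable fun p : (Fin N → ℂ) × ℂ => ∑ n, a n * p.1 n + b * p.2 := by fun_prop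
  have := Measure.isProbabilityMeasure_map
    (μ := (Measure.pi fun _ : Fin N => complexNormal u).prod (complexNormal v)) hm.aemeasurable
  apply Measure.ext_of_charFun
  funext z
  rw [charFun_complexNormal (by positivity), charFun_apply,
    integral_map hm.aemeasurable (by fun_prop)]
  have hinner : ∀ x y w : ℂ, inner ℝ (x * y) w = inner ℝ y (starRingEnd ℂ x * w) := by
    intro x y w
    simp [Complex.inner]
    ring
  have h : ∀ p : (Fin N → ℂ) × ℂ,
      Complex.exp ((inner ℝ (∑ n, a n * p.1 n + b * p.2) z : ℝ) * Complex.I) =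
      (∏ n, Complex.exp ((inner ℝ (p.1 n) (starRingEnd ℂ (a n) * z) : ℝ) * Complex.I)) *
        Complex.exp ((inner ℝ p.2 (starRingEnd ℂ b * z) : ℝ) * Complex.I) := by
    intro p
    rw [← Complex.exp_sum, ← Complex.exp_add, inner_add_left, sum_inner, hinner,
      ← Finset.sum_mul, ← add_mul]
    simp_rw [hinner]
    push_cast
    rfl
  simp_rw [h]
  rw [integral_prod_mul (fun x : Fin N → ℂ => ∏ n, Complex.exp
    ((inner ℝ (x n) (starRingEnd ℂ (a n) * z) : ℝ) * Complex.I)) (fun y : ℂ =>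
    Complex.exp ((inner ℝ y (starRingEnd ℂ b * z) : ℝ) * Complex.I)),
    integral_fintype_prod_eq_prod (fun n (x : ℂ) => Complex.exp
    ((inner ℝ x (starRingEnd ℂ (a n) * z) : ℝ) * Complex.I))]
  simp_rw [← charFun_apply, charFun_complexNormal hu, charFun_complexNormal hv]
  rw [← Complex.exp_sum, ← Complex.exp_add]
  congr 1
  simp only [norm_mul, RCLike.norm_conj, mul_pow]
  push_cast
  rw [Finset.sum_neg_distrib, ← Finset.sum_div, ← Finset.mul_sum, ← Finset.sum_mul]
  ring

theorem map_re_complexNormal (u : ℝ) :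
    (complexNormal u).map Complex.re = gaussianReal 0 (u / 2).toNNReal := by
  rw [complexNormal, Measure.map_map (by fun_prop) (by fun_prop)]
  have : Complex.re ∘ Complex.measurableEquivRealProd.symm = Prod.fst := by
    ext x; simp [Complex.measurableEquivRealProd_symm_apply]
  rw [this, Measure.map_fst_prod]
  simp

theorem integral_exp_mul_sq_gaussianReal {v l : ℝ} (hv : 0 < v) (hl : l < 1) :
    Integrable (fun x : ℝ => Real.exp (l * (x ^ 2 / (2 * v)))) (gaussianReal 0 v.toNNReal) ∧
    ∫ x, Real.exp (l * (x ^ 2 / (2 * v))) ∂gaussianReal 0 v.toNNReal = (√(1 - l))⁻¹ := by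
  have hv' : v.toNNReal ≠ 0 := by simpa using hv
  have hb : 0 < (1 - l) / (2 * v) := by
    have := sub_pos.2 hl
    positivity
  have hpdf : ∀ x : ℝ, gaussianPDFReal 0 v.toNNReal x * Real.exp (l * (x ^ 2 / (2 * v))) =
      (√(2 * Real.pi * v))⁻¹ * Real.exp (-((1 - l) / (2 * v)) * x ^ 2) := by
    intro x
    rw [gaussianPDFReal, Real.coe_toNNReal _ hv.le, mul_assoc, ← Real.exp_add]
    congr 2
    ring
  constructor
  · rw [gaussianReal_of_var_ne_zero _ hv', integrable_withDensity_iff (by fun_prop)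
      (by simp [gaussianPDF])]
    simp_rw [toReal_gaussianPDF, mul_comm (Real.exp _), hpdf]
    exact (integrable_exp_neg_mul_sq hb).const_mul _
  · rw [integral_gaussianReal_eq_integral_smul hv']
    simp_rw [smul_eq_mul, hpdf]
    rw [integral_const_mul, integral_gaussian, ← Real.sqrt_inv, ← Real.sqrt_mul (by positivity),
      ← Real.sqrt_inv]
    congr 1
    have := (sub_pos.2 hl).ne'
    field_simp

/-- The normalized power of a complex Gaussian is a standard exponential variable; the real and
imaginary parts contribute (1-l)^(-1/2) each. -/
theorem integral_exp_mul_normSq_complexNormal {u l : ℝ} (hu : 0 < u) (hl : l < 1) :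
    Integrable (fun z : ℂ => Real.exp (l * (‖z‖ ^ 2 / u))) (complexNormal u) ∧
    ∫ z, Real.exp (l * (‖z‖ ^ 2 / u)) ∂complexNormal u = (1 - l)⁻¹ := by
  obtain ⟨hi, hI⟩ := integral_exp_mul_sq_gaussianReal (half_pos hu) hl
  have h : ∀ x : ℝ × ℝ, Real.exp (l * (‖Complex.measurableEquivRealProd.symm x‖ ^ 2 / u)) =
      Real.exp (l * (x.1 ^ 2 / (2 * (u / 2)))) * Real.exp (l * (x.2 ^ 2 / (2 * (u / 2)))) := by
    intro x
    rw [← Real.exp_add, ← Complex.normSq_eq_norm_sq, Complex.normSq_apply,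
      Complex.measurableEquivRealProd_symm_apply]
    congr 1
    field_simp
  constructor
  · rw [complexNormal, integrable_map_measure (by fun_prop) (by fun_prop)]
    exact (hi.mul_prod hi).congr (ae_of_all _ fun x => (h x).symm)
  · rw [complexNormal, integral_map (by fun_prop) (by fun_prop)]
    simp_rw [h]
    rw [integral_prod_mul (fun x : ℝ => Real.exp (l * (x ^ 2 / (2 * (u / 2)))))
      (fun x : ℝ => Real.exp (l * (x ^ 2 / (2 * (u / 2))))), hI, ← mul_inv,
      Real.mul_self_sqrt (sub_pos.2 hl).le]

/-- The density on the window `[s - w, s]` is at least its value at `s`. This crude bound loses only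
polynomial factors, which is affordable here. -/
theorem le_measure_gaussianReal {v s w : ℝ} (hv : 0 < v) (hw : 0 ≤ w) (hws : w ≤ s) :
    w * ((√(2 * Real.pi * v))⁻¹ * Real.exp (-s ^ 2 / (2 * v))) ≤
      (gaussianReal 0 v.toNNReal).real (Set.Ici (s - w)) := by
  have hv' : v.toNNReal ≠ 0 := by simpa using hv
  calc w * ((√(2 * Real.pi * v))⁻¹ * Real.exp (-s ^ 2 / (2 * v)))
      = ∫ _ in Set.Icc (s - w) s, (√(2 * Real.pi * v))⁻¹ * Real.exp (-s ^ 2 / (2 * v)) := by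
        simp [hw]
    _ ≤ ∫ x in Set.Icc (s - w) s, gaussianPDFReal 0 v.toNNReal x := by
        refine setIntegral_mono_on continuous_const.integrableOn_Icc (integrable_gaussianPDFReal _ _).integrableOn
          measurableSet_Icc fun x hx => ?_
        rw [gaussianPDFReal, Real.coe_toNNReal _ hv.le]
        have h0 : x ^ 2 ≤ s ^ 2 := pow_le_pow_left₀ (by linarith [hx.1]) hx.2 2
        rw [sub_zero]
        gcongr
    _ = (gaussianReal 0 v.toNNReal).real (Set.Icc (s - w) s) := by
        rw [measureReal_def, gaussianReal_apply_eq_integral _ hv', ENNReal.toReal_ofReal]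
        exact integral_nonneg fun x => gaussianPDFReal_nonneg _ _ _
    _ ≤ _ := measureReal_mono Set.Icc_subset_Ici_self

/-- A uniform phase, shifted by any fixed angle, is close to the direction of the positive real axis
with at least the expected probability. -/
theorem le_measure_phaseLaw_cos (s : ℝ) {ε : ℝ} (hε : 0 ≤ ε) (hε' : ε ≤ Real.pi) :
    ε / (2 * Real.pi) ≤ phaseLaw.real {x | 1 - ε ^ 2 / 2 ≤ Real.cos (x + s)} := by
  have hpi := Real.pi_pos
  obtain ⟨y, hy, m, hm⟩ : ∃ y ∈ Set.Ico (0 : ℝ) (2 * Real.pi), ∃ m : ℤ,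
      y + s = m * (2 * Real.pi) := by
    refine ⟨toIcoMod Real.two_pi_pos 0 (-s), ?_, -toIcoDiv Real.two_pi_pos 0 (-s), ?_⟩
    · simpa using toIcoMod_mem_Ico Real.two_pi_pos 0 (-s)
    · have := self_sub_toIcoDiv_zsmul Real.two_pi_pos 0 (-s)
      rw [← this, zsmul_eq_mul]; push_cast; ring
  have key : ∀ x, |x - y| ≤ ε → 1 - ε ^ 2 / 2 ≤ Real.cos (x + s) := by
    intro x hx
    have h1 : x + s = (x - y) + m * (2 * Real.pi) := by linarith
    rw [h1, Real.cos_add_int_mul_two_pi]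
    have h2 := Real.one_sub_sq_div_two_le_cos (x := x - y)
    have h3 : (x - y) ^ 2 ≤ ε ^ 2 := sq_le_sq' (abs_le.1 hx).1 (abs_le.1 hx).2
    linarith
  -- A one-sided neighbourhood of `y` is used, on whichever side stays inside `[0, 2π]`; it fits
  -- because `ε ≤ π`.
  obtain ⟨p, hp0, hp1, hp⟩ : ∃ p, 0 ≤ p ∧ p + ε ≤ 2 * Real.pi ∧
      ∀ x ∈ Set.Icc p (p + ε), |x - y| ≤ ε := by
    rcases le_total y Real.pi with h | h
    · exact ⟨y, hy.1, by linarith, fun x hx => abs_le.2 ⟨by linarith [hx.1], by linarith [hx.2]⟩⟩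
    · exact ⟨y - ε, by linarith, by linarith [hy.2],
        fun x hx => abs_le.2 ⟨by linarith [hx.1], by linarith [hx.2]⟩⟩
  calc ε / (2 * Real.pi) = phaseLaw.real (Set.Icc p (p + ε)) := by
        rw [measureReal_def, phaseLaw, cond_apply measurableSet_Icc,
          Set.inter_eq_self_of_subset_right (Set.Icc_subset_Icc hp0 hp1)]
        simp [hε, hpi.le, ENNReal.toReal_mul, ENNReal.toReal_inv]
        field_simp
    _ ≤ _ := measureReal_mono fun x hx => key x (hp x hx)

end

/-! ### Line-of-sight and scattered parts of one user's channel. -/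

section

variable {N : ℕ}

/-- The fading sources of a user with a given tuple of values. -/
def UserFading.ofTuple (t : (Fin N → ℝ) × (Fin N → ℂ) × ℝ × ℂ) : UserFading N :=
  ⟨t.1, t.2.1, t.2.2.1, t.2.2.2⟩

theorem UserFading.ofTuple_toTuple (x : UserFading N) : ofTuple x.toTuple = x := rfl

/-- The phase of the path through the `n`-th surface element, up to the surface-to-user link. -/
def elementPhase (c : Subchannel N) (θ : Fin N → ℝ) (n : Fin N) : ℝ :=
  2 * Real.pi * (n : ℕ) * c.d * Real.sin (c.ϑ n) + θ n

/-- The coefficient of the `n`-th surface-to-user link in the overall channel. -/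
def elementCoeff (β : ℝ) (c : Subchannel N) (θ : Fin N → ℝ) (n : Fin N) : ℂ :=
  ((√c.ρR * β : ℝ) : ℂ) * Complex.exp (elementPhase c θ n * Complex.I)

/-- The contribution of the scattered paths to the overall channel. -/
def scattered (β : ℝ) (c : Subchannel N) (θ : Fin N → ℝ)
    (t : (Fin N → ℝ) × (Fin N → ℂ) × ℝ × ℂ) : ℂ :=
  ∑ n, elementCoeff β c θ n * t.2.1 n + (√c.ρB : ℂ) * t.2.2.2

/-- The amplitude of the sum of all line-of-sight paths when they add up coherently. -/
def losGain (β : ℝ) (c : Subchannel N) : ℝ :=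
  N * β * √(c.ρR * c.κ / (1 + c.κ)) + √(c.ρB * c.κB / (1 + c.κB))

/-- The variance of the sum of all scattered paths. -/
def scatterVar (β : ℝ) (c : Subchannel N) : ℝ :=
  c.ρR * N * β ^ 2 / (1 + c.κ) + c.ρB / (1 + c.κB)

theorem ξ_eq (β : ℝ) (c : Subchannel N) (K : ℕ) :
    ξ β c K = (√(scatterVar β c * Real.log K) + losGain β c) ^ 2 := by
  rw [ξ, scatterVar, losGain, add_assoc]

/-- Nonnegativity of the parameters of a sub-channel. -/
structure Subchannel.Nonneg (c : Subchannel N) : Prop where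
  ρR : 0 ≤ c.ρR
  ρB : 0 ≤ c.ρB
  κ : 0 ≤ c.κ
  κB : 0 ≤ c.κB

theorem losGain_nonneg {β : ℝ} (hβ : 0 ≤ β) (c : Subchannel N) : 0 ≤ losGain β c := by
  unfold losGain; positivity

theorem Subchannel.Nonneg.scatterVar_nonneg {c : Subchannel N} (hc : c.Nonneg) (β : ℝ) :
    0 ≤ scatterVar β c := by
  obtain ⟨h1, h2, h3, h4⟩ := hc
  unfold scatterVar; positivity

theorem channel_ofTuple (β : ℝ) (c : Subchannel N) (θ : Fin N → ℝ)
    (t : (Fin N → ℝ) × (Fin N → ℂ) × ℝ × ℂ) :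
    channel β c θ (UserFading.ofTuple t) =
      (∑ n, ((√c.ρR * β * √(c.κ / (1 + c.κ)) : ℝ) : ℂ) *
        Complex.exp ((t.1 n + elementPhase c θ n : ℝ) * Complex.I)) +
      ((√c.ρB * √(c.κB / (1 + c.κB)) : ℝ) : ℂ) * Complex.exp (t.2.2.1 * Complex.I) +
      scattered β c θ t := by
  simp only [channel, dotProduct, surfaceResponse, Matrix.smul_mulVec, Pi.smul_apply,
    Matrix.mulVec_diagonal, smul_eq_mul, h1, h2, hd, scattered, elementCoeff, elementPhase,
    UserFading.ofTuple]
  rw [Finset.mul_sum, mul_add, ← add_assoc, ← add_assoc, add_right_comm (Finset.sum _ _) _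
    (Finset.sum _ _), ← Finset.sum_add_distrib]
  congr 2
  · refine Finset.sum_congr rfl fun n _ => ?_
    push_cast
    simp only [add_mul, Complex.exp_add, mul_comm Complex.I]
    ring
  · push_cast
    simp only [mul_comm Complex.I]
    ring

theorem Subchannel.Nonneg.losGain_eq {c : Subchannel N} (hc : c.Nonneg) (β : ℝ) :
    losGain β c = (∑ _n : Fin N, √c.ρR * β * √(c.κ / (1 + c.κ))) +
      √c.ρB * √(c.κB / (1 + c.κB)) := by
  rw [losGain, mul_div_assoc, mul_div_assoc, Real.sqrt_mul hc.ρR, Real.sqrt_mul hc.ρB]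
  simp
  ring

theorem Subchannel.Nonneg.norm_channel_le {c : Subchannel N} (hc : c.Nonneg) {β : ℝ} (hβ : 0 ≤ β)
    (θ : Fin N → ℝ) (t : (Fin N → ℝ) × (Fin N → ℂ) × ℝ × ℂ) :
    ‖channel β c θ (UserFading.ofTuple t)‖ ≤ losGain β c + ‖scattered β c θ t‖ := by
  rw [channel_ofTuple, hc.losGain_eq]
  refine (norm_add_le _ _).trans (add_le_add_left ((norm_add_le _ _).trans
    (add_le_add ((norm_sum_le _ _).trans (Finset.sum_le_sum fun n _ => ?_)) ?_)) _)
  · rw [norm_mul, Complex.norm_exp_ofReal_mul_I, mul_one, Complex.norm_real, Real.norm_of_nonneg]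
    positivity
  · rw [norm_mul, Complex.norm_exp_ofReal_mul_I, mul_one, Complex.norm_real, Real.norm_of_nonneg]
    positivity

/-- The modulus dominates the real part, to which each line-of-sight path contributes its amplitude
times a cosine. -/
theorem Subchannel.Nonneg.le_norm_channel {c : Subchannel N} (hc : c.Nonneg) {β : ℝ} (hβ : 0 ≤ β)
    (θ : Fin N → ℝ) (t : (Fin N → ℝ) × (Fin N → ℂ) × ℝ × ℂ) {η : ℝ}
    (h : ∀ n, η ≤ Real.cos (t.1 n + elementPhase c θ n)) (h' : η ≤ Real.cos t.2.2.1) :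
    losGain β c * η + (scattered β c θ t).re ≤ ‖channel β c θ (UserFading.ofTuple t)‖ := by
  refine le_trans ?_ (Complex.re_le_norm _)
  rw [channel_ofTuple, hc.losGain_eq, Complex.add_re, Complex.add_re, Complex.re_sum,
    add_mul, Finset.sum_mul]
  simp_rw [Complex.re_ofReal_mul, Complex.exp_ofReal_mul_I_re]
  gcongr with n
  exact h n

/-- Regrouping of the fading sources of a user into phases and scattered components. -/
theorem measurePreserving_regroup (κ κB : ℝ) :
    MeasurePreserving (fun t : (Fin N → ℝ) × (Fin N → ℂ) × ℝ × ℂ =>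
        ((t.1, t.2.2.1), (t.2.1, t.2.2.2)))
      (userLaw N κ κB)
      (((Measure.pi fun _ => phaseLaw).prod phaseLaw).prod
        ((Measure.pi fun _ => complexNormal (1 / (1 + κ))).prod
          (complexNormal (1 / (1 + κB))))) := by
  let p : Measure (Fin N → ℝ) := Measure.pi fun _ => phaseLaw
  let q : Measure (Fin N → ℂ) := Measure.pi fun _ => complexNormal (1 / (1 + κ))
  let r := complexNormal (1 / (1 + κB))
  have h1 := (measurePreserving_prodAssoc q phaseLaw r).symm
  have h2 := (Measure.measurePreserving_swap (μ := q) (ν := phaseLaw)).prod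
    (MeasurePreserving.id r)
  have h3 := measurePreserving_prodAssoc phaseLaw q r
  have h4 := (MeasurePreserving.id p).prod (h3.comp (h2.comp h1))
  have h5 := (measurePreserving_prodAssoc p phaseLaw (q.prod r)).symm
  exact h5.comp h4

/-- The contribution of the scattered paths, as a function of the scattered components alone. -/
def scatteredSum (β : ℝ) (c : Subchannel N) (θ : Fin N → ℝ) (p : (Fin N → ℂ) × ℂ) : ℂ :=
  ∑ n, elementCoeff β c θ n * p.1 n + (√c.ρB : ℂ) * p.2

theorem measurable_scatteredSum (β : ℝ) (c : Subchannel N) (θ : Fin N → ℝ) :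
    Measurable (scatteredSum β c θ) := by
  unfold scatteredSum
  fun_prop

/-- The surface only rotates the coefficients, all of squared modulus `c.ρR * β ^ 2`, so the law
does not depend on `θ`. -/
theorem map_scatteredSum {c : Subchannel N} (hc : c.Nonneg) (β : ℝ) (θ : Fin N → ℝ) :
    ((Measure.pi fun _ : Fin N => complexNormal (1 / (1 + c.κ))).prod
      (complexNormal (1 / (1 + c.κB)))).map (scatteredSum β c θ) =
      complexNormal (scatterVar β c) := by
  have hκ := hc.κ
  have hκB := hc.κB
  unfold scatteredSum
  rw [map_linearCombination_complexNormal (by positivity) (by positivity)]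
  congr 1
  have hn : ∀ n, ‖elementCoeff β c θ n‖ ^ 2 = c.ρR * β ^ 2 := by
    intro n
    rw [elementCoeff, norm_mul, Complex.norm_exp_ofReal_mul_I, mul_one, Complex.norm_real,
      Real.norm_eq_abs, sq_abs, mul_pow, Real.sq_sqrt hc.ρR]
  simp_rw [hn]
  rw [Complex.norm_real, Real.norm_eq_abs, sq_abs, Real.sq_sqrt hc.ρB, scatterVar]
  simp
  ring

theorem map_scattered {c : Subchannel N} (hc : c.Nonneg) (β : ℝ) (θ : Fin N → ℝ) :
    (userLaw N c.κ c.κB).map (scattered β c θ) = complexNormal (scatterVar β c) := by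
  have h := measurePreserving_snd.comp (measurePreserving_regroup (N := N) c.κ c.κB)
  have h0 : scattered β c θ = scatteredSum β c θ ∘
      (Prod.snd ∘ fun t : (Fin N → ℝ) × (Fin N → ℂ) × ℝ × ℂ =>
        ((t.1, t.2.2.1), (t.2.1, t.2.2.2))) := rfl
  rw [h0, ← Measure.map_map (measurable_scatteredSum β c θ) (by fun_prop), h.map_eq,
    map_scatteredSum hc]

theorem measurable_scattered (β : ℝ) (c : Subchannel N) :
    Measurable fun p : (Fin N → ℝ) × (Fin N → ℝ) × (Fin N → ℂ) × ℝ × ℂ =>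
      scattered β c p.1 p.2 := by
  unfold scattered elementCoeff elementPhase
  fun_prop

theorem measurable_channel (β : ℝ) (c : Subchannel N) :
    Measurable fun p : (Fin N → ℝ) × (Fin N → ℝ) × (Fin N → ℂ) × ℝ × ℂ =>
      channel β c p.1 (UserFading.ofTuple p.2) := by
  simp_rw [channel_ofTuple]
  have := measurable_scattered β c
  unfold elementPhase
  fun_prop

theorem userLaw_real_regroup (κ κB : ℝ) {A : Fin N → Set ℝ} {B : Set ℝ} {D : Set ((Fin N → ℂ) × ℂ)}
    (hA : ∀ n, MeasurableSet (A n)) (hB : MeasurableSet B) (hD : MeasurableSet D) :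
    (userLaw N κ κB).real {t | (∀ n, t.1 n ∈ A n) ∧ t.2.2.1 ∈ B ∧ (t.2.1, t.2.2.2) ∈ D} =
      (∏ n, phaseLaw.real (A n)) * phaseLaw.real B *
        ((Measure.pi fun _ : Fin N => complexNormal (1 / (1 + κ))).prod
          (complexNormal (1 / (1 + κB)))).real D := by
  have h : {t : (Fin N → ℝ) × (Fin N → ℂ) × ℝ × ℂ |
      (∀ n, t.1 n ∈ A n) ∧ t.2.2.1 ∈ B ∧ (t.2.1, t.2.2.2) ∈ D} =
      (fun t => ((t.1, t.2.2.1), (t.2.1, t.2.2.2))) ⁻¹' (((Set.univ.pi A) ×ˢ B) ×ˢ D) := by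
    ext t
    simp [and_assoc]
  have hE : MeasurableSet (((Set.univ.pi A) ×ˢ B) ×ˢ D) :=
    ((MeasurableSet.univ_pi hA).prod hB).prod hD
  rw [h, measureReal_def,
    (measurePreserving_regroup κ κB).measure_preimage hE.nullMeasurableSet,
    Measure.prod_prod, Measure.prod_prod, Measure.pi_pi, ENNReal.toReal_mul, ENNReal.toReal_mul,
    ENNReal.toReal_prod]
  rfl

/-- Whatever the surface phases, the channel of a user is strong with at least the probability that
all the line-of-sight phases are within `ε` of alignment and that the scattered part has a large
real part. -/
theorem le_userLaw_norm_channel {c : Subchannel N} (hc : c.Nonneg) {β : ℝ} (hβ : 0 ≤ β)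
    (θ : Fin N → ℝ) {ε s : ℝ} (hε : 0 ≤ ε) (hε' : ε ≤ Real.pi) :
    (ε / (2 * Real.pi)) ^ (N + 1) *
        (gaussianReal 0 (scatterVar β c / 2).toNNReal).real (Set.Ici s) ≤
      (userLaw N c.κ c.κB).real {t | losGain β c * (1 - ε ^ 2 / 2) + s ≤
        ‖channel β c θ (UserFading.ofTuple t)‖} := by
  have hC : ∀ a, MeasurableSet {x | 1 - ε ^ 2 / 2 ≤ Real.cos (x + a)} := fun a =>
    measurableSet_le measurable_const (by fun_prop)
  have hf := measurable_scatteredSum β c θ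
  have hS := hf (Complex.measurable_re (measurableSet_Ici (a := s)))
  -- The Gaussian tail becomes an event for the scattered components, independent of all the phases.
  rw [← map_re_complexNormal, ← map_scatteredSum hc β θ,
    map_measureReal_apply Complex.measurable_re measurableSet_Ici,
    map_measureReal_apply hf (Complex.measurable_re measurableSet_Ici)]
  have hpow : (ε / (2 * Real.pi)) ^ (N + 1) ≤
      (∏ n, phaseLaw.real {x | 1 - ε ^ 2 / 2 ≤ Real.cos (x + elementPhase c θ n)}) *
        phaseLaw.real {x | 1 - ε ^ 2 / 2 ≤ Real.cos (x + 0)} := by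
    have h0 : (ε / (2 * Real.pi)) ^ N = ∏ _n : Fin N, ε / (2 * Real.pi) := by
      rw [Finset.prod_const, Finset.card_univ, Fintype.card_fin]
    rw [pow_succ, h0]
    exact mul_le_mul (Finset.prod_le_prod (fun _ _ => by positivity)
      fun n _ => le_measure_phaseLaw_cos _ hε hε') (le_measure_phaseLaw_cos 0 hε hε')
      (by positivity) (by positivity)
  refine (mul_le_mul_of_nonneg_right hpow measureReal_nonneg).trans ?_
  rw [← userLaw_real_regroup c.κ c.κB (fun n => hC _) (hC 0) hS]
  refine measureReal_mono fun t ht => ?_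
  obtain ⟨h1, h2, h3⟩ := ht
  refine le_trans (add_le_add_right ?_ _) (hc.le_norm_channel hβ θ t h1 (by simpa using h2))
  exact h3

/-- Without scattering there is no channel at all. -/
theorem Subchannel.Nonneg.eq_zero_of_scatterVar {c : Subchannel N} (hc : c.Nonneg) {β : ℝ}
    (h : scatterVar β c = 0) : losGain β c = 0 ∧
      ∀ (θ : Fin N → ℝ) (t : (Fin N → ℝ) × (Fin N → ℂ) × ℝ × ℂ), scattered β c θ t = 0 := by
  obtain ⟨h1, h2, h3, h4⟩ := hc
  rw [scatterVar, add_eq_zero_iff_of_nonneg (by positivity) (by positivity), div_eq_zero_iff,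
    div_eq_zero_iff, or_iff_left (by positivity), or_iff_left (by positivity)] at h
  obtain ⟨hR, hB⟩ := h
  simp only [mul_eq_zero, pow_eq_zero_iff two_ne_zero, Nat.cast_eq_zero] at hR
  refine ⟨?_, fun θ t => ?_⟩
  · rcases hR with (h | h) | h <;> simp [losGain, h, hB]
  · rcases hR with (h | h) | h
    · simp [scattered, elementCoeff, h, hB]
    · subst h
      simp [scattered, hB]
    · simp [scattered, elementCoeff, h, hB]

end

/-! ### Mean rate of the best user: upper and lower bounds for fixed K. -/

section

variable {N : ℕ} {Ω : Type*} [MeasurableSpace Ω] {P : Measure Ω} [IsProbabilityMeasure P]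

theorem IndependentRicianFading.hasLaw_users {κ κB : ℝ} {θ : Ω → Fin N → ℝ}
    {X : ℕ → Ω → UserFading N} (h : IndependentRicianFading P κ κB θ X) (K : ℕ) :
    HasLaw (fun ω => (θ ω, fun k : Fin K => (X k ω).toTuple))
      ((Measure.pi fun _ => phaseLaw).prod (Measure.pi fun _ => userLaw N κ κB)) P := by
  have hY : HasLaw (fun ω (k : Fin K) => (X k ω).toTuple)
      (Measure.pi fun _ => userLaw N κ κB) P :=
    (h.users_indep.precomp Fin.val_injective).hasLaw_pi fun k => h.user_law k
  have hi : IndepFun θ (fun ω (k : Fin K) => (X k ω).toTuple) P :=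
    h.phase_indep.comp (φ := id)
      (ψ := fun (y : ℕ → (Fin N → ℝ) × (Fin N → ℂ) × ℝ × ℂ) (k : Fin K) => y k) measurable_id (by fun_prop)
  exact (indepFun_iff_hasLaw_prodMk_prod h.phase_law hY).1 hi

theorem IndependentRicianFading.hasLaw_user {κ κB : ℝ} {θ : Ω → Fin N → ℝ}
    {X : ℕ → Ω → UserFading N} (h : IndependentRicianFading P κ κB θ X) (k : ℕ) :
    HasLaw (fun ω => (θ ω, (X k ω).toTuple))
      ((Measure.pi fun _ => phaseLaw).prod (userLaw N κ κB)) P := by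
  have hi : IndepFun θ (fun ω => (X k ω).toTuple) P :=
    h.phase_indep.comp (φ := id)
      (ψ := fun y : ℕ → (Fin N → ℝ) × (Fin N → ℂ) × ℝ × ℂ => y k) measurable_id (by fun_prop)
  exact (indepFun_iff_hasLaw_prodMk_prod h.phase_law (h.user_law k)).1 hi

/-- A mixture of equal conditional laws is that law. -/
theorem map_prod_eq_of_forall_map_eq {S T E : Type*} [MeasurableSpace S] [MeasurableSpace T]
    [MeasurableSpace E] {μ : Measure S} [IsProbabilityMeasure μ] {ν : Measure T} [SFinite ν]
    {ρ : Measure E} {f : S × T → E} (hf : Measurable f)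
    (h : ∀ x, ν.map (fun t => f (x, t)) = ρ) : (μ.prod ν).map f = ρ := by
  ext s hs
  have hx : ∀ x, ν (Prod.mk x ⁻¹' (f ⁻¹' s)) = ρ s := by
    intro x
    have hfx : Measurable fun t => f (x, t) := hf.comp measurable_prodMk_left
    rw [← h x, Measure.map_apply hfx hs]
    rfl
  rw [Measure.map_apply hf hs, Measure.prod_apply (hf hs), lintegral_congr hx, lintegral_const,
    measure_univ, mul_one]

theorem map_prod_scattered {c : Subchannel N} (hc : c.Nonneg) (β : ℝ) :
    ((Measure.pi fun _ => phaseLaw).prod (userLaw N c.κ c.κB)).map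
      (fun p : (Fin N → ℝ) × (Fin N → ℝ) × (Fin N → ℂ) × ℝ × ℂ => scattered β c p.1 p.2) =
      complexNormal (scatterVar β c) := by
  apply map_prod_eq_of_forall_map_eq (measurable_scattered β c)
  exact fun x => map_scattered hc β x

theorem hasLaw_scattered {β : ℝ} {c : Subchannel N} (hc : c.Nonneg) {θ : Ω → Fin N → ℝ}
    {X : ℕ → Ω → UserFading N} (h : IndependentRicianFading P c.κ c.κB θ X) (k : ℕ) :
    HasLaw (fun ω => scattered β c (θ ω) (X k ω).toTuple) (complexNormal (scatterVar β c)) P := by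
  have hlaw : HasLaw (fun p : (Fin N → ℝ) × (Fin N → ℝ) × (Fin N → ℂ) × ℝ × ℂ =>
      scattered β c p.1 p.2) (complexNormal (scatterVar β c))
      ((Measure.pi fun _ => phaseLaw).prod (userLaw N c.κ c.κB)) :=
    ⟨(measurable_scattered β c).aemeasurable, map_prod_scattered hc β⟩
  have := hlaw.fun_comp (h.hasLaw_user k)
  exact this

/-- Given the phases of the surface, the users are independent. -/
theorem measureReal_forall_lt_le {β : ℝ} {c : Subchannel N} {θ : Ω → Fin N → ℝ}
    {X : ℕ → Ω → UserFading N} (h : IndependentRicianFading P c.κ c.κB θ X) (K : ℕ) {r p : ℝ}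
    (hp : ∀ x, p ≤ (userLaw N c.κ c.κB).real
      {t | r ≤ ‖channel β c x (UserFading.ofTuple t)‖}) :
    P.real {ω | ∀ k : Fin K, ‖channel β c (θ ω) (X k ω)‖ < r} ≤ (1 - p) ^ K := by
  have hch := measurable_channel β c
  have hp1 : 0 ≤ 1 - p := sub_nonneg.2 ((hp 0).trans measureReal_le_one)
  let S : Set ((Fin N → ℝ) × (Fin K → (Fin N → ℝ) × (Fin N → ℂ) × ℝ × ℂ)) :=
    {q | ∀ k, ‖channel β c q.1 (UserFading.ofTuple (q.2 k))‖ < r}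
  have hS : MeasurableSet S := by
    have : S = ⋂ k, {q | ‖channel β c q.1 (UserFading.ofTuple (q.2 k))‖ < r} := by
      ext q; simp [S]
    rw [this]
    refine MeasurableSet.iInter fun k => measurableSet_lt ?_ measurable_const
    have hk : Measurable fun q : (Fin N → ℝ) × (Fin K → (Fin N → ℝ) × (Fin N → ℂ) × ℝ × ℂ) =>
      (q.1, q.2 k) := by fun_prop
    exact (hch.comp hk).norm
  have hslice : ∀ x : Fin N → ℝ, (Measure.pi fun _ : Fin K => userLaw N c.κ c.κB)
      (Prod.mk x ⁻¹' S) ≤ ENNReal.ofReal ((1 - p) ^ K) := by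
    intro x
    have hx : Prod.mk x ⁻¹' S = Set.univ.pi fun _ : Fin K =>
        {t | r ≤ ‖channel β c x (UserFading.ofTuple t)‖}ᶜ := by
      ext y; simp [S]
    have hm : MeasurableSet {t | r ≤ ‖channel β c x (UserFading.ofTuple t)‖} :=
      measurableSet_le measurable_const (hch.comp measurable_prodMk_left).norm
    rw [hx, Measure.pi_pi, Finset.prod_const, Finset.card_univ, Fintype.card_fin,
      ENNReal.ofReal_pow hp1]
    gcongr
    rw [← ofReal_measureReal, probReal_compl_eq_one_sub hm]
    exact ENNReal.ofReal_le_ofReal (by linarith [hp x])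
  have hle : P {ω | ∀ k : Fin K, ‖channel β c (θ ω) (X k ω)‖ < r} ≤
      ENNReal.ofReal ((1 - p) ^ K) := by
    have h1 := (h.hasLaw_users K).measure_eq (p := fun q => q ∈ S) hS
    have h2 : {ω | ∀ k : Fin K, ‖channel β c (θ ω) (X k ω)‖ < r} =
      {ω | (θ ω, fun k : Fin K => (X k ω).toTuple) ∈ S} := rfl
    rw [h2, h1, Set.ofPred_mem_eq, Measure.prod_apply hS]
    refine (lintegral_mono hslice).trans ?_
    simp
  exact ENNReal.toReal_le_of_le_ofReal (by positivity) hle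

variable {β : ℝ} {c : Subchannel N} {θ : Ω → Fin N → ℝ} {X : ℕ → Ω → UserFading N}

theorem aemeasurable_snr (h : IndependentRicianFading P c.κ c.κB θ X) (k : ℕ) :
    AEMeasurable (fun ω => snr β c (θ ω) (X k ω)) P := by
  have := (measurable_channel β c).comp_aemeasurable (h.hasLaw_user k).aemeasurable
  exact this.norm.pow_const 2

theorem aemeasurable_bestUserRate (h : IndependentRicianFading P c.κ c.κB θ X) (K : ℕ) :
    AEMeasurable (fun ω => bestUserRate β c K (θ ω) (fun k => X k ω)) P := by
  have : AEMeasurable (fun ω => ⨆ k : Fin K, snr β c (θ ω) (X k ω)) P :=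
    AEMeasurable.iSup fun k => aemeasurable_snr h k
  exact (Real.measurable_log.comp_aemeasurable (this.const_add 1)).div_const _

theorem iSup_snr_nonneg (β : ℝ) (c : Subchannel N) (K : ℕ) (x : Fin N → ℝ) (y : ℕ → UserFading N) :
    0 ≤ ⨆ k : Fin K, snr β c x (y k) :=
  Real.iSup_nonneg fun _ => sq_nonneg _

theorem bestUserRate_nonneg (β : ℝ) (c : Subchannel N) (K : ℕ) (x : Fin N → ℝ)
    (y : ℕ → UserFading N) : 0 ≤ bestUserRate β c K x y :=
  Real.logb_nonneg one_lt_two (by linarith [iSup_snr_nonneg β c K x y])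

/-- The upper bound for the mean rate that follows from the exponential moments of the power of the
scattered part. -/
theorem integral_bestUserRate_le (hβ : 0 ≤ β) (hc : c.Nonneg) (hv : 0 < scatterVar β c)
    (h : IndependentRicianFading P c.κ c.κB θ X) {K : ℕ} (hK : 1 ≤ K) {l : ℝ} (hl0 : 0 < l)
    (hl1 : l < 1) (hl : 0 < Real.log (K / (1 - l))) :
    Integrable (fun ω => bestUserRate β c K (θ ω) (fun k => X k ω)) P ∧
    ∫ ω, bestUserRate β c K (θ ω) (fun k => X k ω) ∂P ≤
      Real.logb 2 (1 + (√(scatterVar β c * (Real.log (K / (1 - l)) / l)) + losGain β c) ^ 2) := by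
  set v := scatterVar β c with hvdef
  set A := losGain β c with hAdef
  set τ := Real.log (K / (1 - l)) with hτdef
  have hA : 0 ≤ A := losGain_nonneg hβ c
  have : Nonempty (Fin K) := ⟨⟨0, hK⟩⟩
  have hK0 : (0 : ℝ) < K := by exact_mod_cast hK
  have hl1' : 0 < 1 - l := sub_pos.2 hl1
  set B := √(v * (τ / l)) with hBdef
  have hB : 0 < B := Real.sqrt_pos.2 (by positivity)
  have hB2 : B ^ 2 = v * (τ / l) := Real.sq_sqrt (by positivity)
  let E : ℕ → Ω → ℝ := fun k ω =>
    Real.exp (l * (‖scattered β c (θ ω) (X k ω).toTuple‖ ^ 2 / v))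
  obtain ⟨hi, hI⟩ := integral_exp_mul_normSq_complexNormal hv hl1
  have hEi : ∀ k, Integrable (E k) P := fun k => by
    have hg := hasLaw_scattered (β := β) hc h k
    rw [← hvdef] at hg
    rw [← hg.map_eq] at hi
    exact hi.comp_aemeasurable hg.aemeasurable
  have hEI : ∀ k, ∫ ω, E k ω ∂P = (1 - l)⁻¹ := fun k => by
    rw [← hI, ← (hasLaw_scattered (β := β) hc h k).integral_comp (by fun_prop)]
    rfl
  let S : Ω → ℝ := fun ω => ∑ k : Fin K, E k ω
  have hSi : Integrable S P := integrable_finsetSum _ fun k _ => hEi k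
  have hSI : ∫ ω, S ω ∂P = Real.exp τ := by
    simp only [S]
    rw [integral_finsetSum _ fun (k : Fin K) _ => hEi k]
    simp_rw [hEI]
    rw [hτdef, Real.exp_log (by positivity)]
    simp
    rfl
  -- From y ≤ e^(y-τ) + τ - 1 with y = l g²/v: `W` bounds every scattered power g². As `S` has mean
  -- e^τ, the mean of `W` is `B ^ 2`.
  let W : Ω → ℝ := fun ω => v / l * (Real.exp (-τ) * S ω + (τ - 1))
  have hWi : Integrable W P := ((hSi.const_mul _).add (integrable_const _)).const_mul _
  have hWI : ∫ ω, W ω ∂P = B ^ 2 := by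
    rw [integral_const_mul, integral_add (hSi.const_mul _) (integrable_const _),
      integral_const_mul, hSI, ← Real.exp_add]
    simp
    rw [hB2]
    field_simp
  let M : Ω → ℝ := fun ω => ⨆ k : Fin K, snr β c (θ ω) (X k ω)
  have hgW : ∀ ω (k : Fin K), ‖scattered β c (θ ω) (X k ω).toTuple‖ ^ 2 ≤ W ω := by
    intro ω k
    have h1 : Real.exp (-τ) * E k ω ≤ Real.exp (-τ) * S ω := by
      gcongr
      exact Finset.single_le_sum (f := fun k : Fin K => E k ω)
        (fun k _ => (Real.exp_pos _).le) (Finset.mem_univ k)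
    have h2 := Real.add_one_le_exp
      (-τ + l * (‖scattered β c (θ ω) (X k ω).toTuple‖ ^ 2 / v))
    rw [Real.exp_add] at h2
    have h3 : l * (‖scattered β c (θ ω) (X k ω).toTuple‖ ^ 2 / v) ≤
        Real.exp (-τ) * S ω + (τ - 1) := by
      linarith
    calc ‖scattered β c (θ ω) (X k ω).toTuple‖ ^ 2
        = v / l * (l * (‖scattered β c (θ ω) (X k ω).toTuple‖ ^ 2 / v)) := by field_simp
      _ ≤ W ω := by
        have : 0 < v / l := by positivity
        exact mul_le_mul_of_nonneg_left h3 this.le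
  -- (A + g)² is made affine in g² by 2g ≤ g²/B + B, with equality at g = B, so the bound equals (A
  -- + B)² when `W` is at its mean.
  have hMW : ∀ ω, M ω ≤ A ^ 2 + A * B + (A / B + 1) * W ω := by
    intro ω
    refine ciSup_le fun k => ?_
    set g := ‖scattered β c (θ ω) (X k ω).toTuple‖ with hg
    have h1 : ‖channel β c (θ ω) (X k ω)‖ ≤ A + g :=
      hc.norm_channel_le hβ (θ ω) (X k ω).toTuple
    have h2 : 2 * g ≤ g ^ 2 / B + B := by
      have := sq_nonneg (g - B)
      rw [← sub_nonneg, show g ^ 2 / B + B - 2 * g = (g - B) ^ 2 / B by field_simp; ring]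
      positivity
    calc snr β c (θ ω) (X k ω) ≤ (A + g) ^ 2 := by
          unfold snr
          gcongr
      _ = A ^ 2 + A * (2 * g) + g ^ 2 := by ring
      _ ≤ A ^ 2 + A * (g ^ 2 / B + B) + g ^ 2 := by gcongr
      _ = A ^ 2 + A * B + (A / B + 1) * g ^ 2 := by ring
      _ ≤ A ^ 2 + A * B + (A / B + 1) * W ω := by
          gcongr
          exact hgW ω k
  set U := 1 + (B + A) ^ 2 with hU
  have hU0 : 0 < U := by positivity
  -- Tangent to the logarithm at `U`, composed with the affine bound above: this replaces Jensen's
  -- inequality and gives integrability as well.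
  let D : Ω → ℝ := fun ω => (Real.log U - 1 + (1 + A ^ 2 + A * B) / U) / Real.log 2 +
    (A / B + 1) / U / Real.log 2 * W ω
  have hDi : Integrable D P := (integrable_const _).add (hWi.const_mul _)
  have hDI : ∫ ω, D ω ∂P = Real.logb 2 U := by
    simp only [D]
    rw [integral_add (integrable_const _) (hWi.const_mul _), integral_const_mul, hWI,
      integral_const, probReal_univ, one_smul, Real.logb]
    have hsum : (1 + A ^ 2 + A * B) / U + (A / B + 1) / U * B ^ 2 = 1 := by
      rw [div_mul_eq_mul_div, ← add_div, div_eq_one_iff_eq hU0.ne', hU]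
      field_simp
      ring
    rw [div_mul_eq_mul_div, ← add_div, add_assoc, hsum, sub_add_cancel]
  have hle : ∀ ω, bestUserRate β c K (θ ω) (fun k => X k ω) ≤ D ω := by
    intro ω
    have hM0 : 0 ≤ M ω := iSup_snr_nonneg β c K (θ ω) fun k => X k ω
    have h1 := Real.log_le_sub_one_of_pos (x := (1 + M ω) / U) (by positivity)
    rw [Real.log_div (by positivity) hU0.ne'] at h1
    have h2 : (1 + M ω) / U ≤ (1 + (A ^ 2 + A * B + (A / B + 1) * W ω)) / U := by
      gcongr
      exact hMW ω
    have h3 : D ω = (Real.log U - 1 +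
        (1 + (A ^ 2 + A * B + (A / B + 1) * W ω)) / U) / Real.log 2 := by
      simp only [D]
      ring
    rw [h3]
    exact div_le_div_of_nonneg_right (by linarith) (Real.log_nonneg one_le_two)
  have hint : Integrable (fun ω => bestUserRate β c K (θ ω) (fun k => X k ω)) P :=
    hDi.mono' (aemeasurable_bestUserRate h K).aestronglyMeasurable (ae_of_all _ fun ω => by
      rw [Real.norm_of_nonneg (bestUserRate_nonneg _ _ _ _ _)]
      exact hle ω)
  exact ⟨hint, (integral_mono hint hDi hle).trans hDI.le⟩

/-- The lower bound for the mean rate by the probability that some user has a strong channel. -/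
theorem le_integral_bestUserRate (h : IndependentRicianFading P c.κ c.κB θ X) {K : ℕ}
    (hint : Integrable (fun ω => bestUserRate β c K (θ ω) (fun k => X k ω)) P) {r p : ℝ}
    (hr : 0 ≤ r) (hp : ∀ x, p ≤ (userLaw N c.κ c.κB).real
      {t | r ≤ ‖channel β c x (UserFading.ofTuple t)‖}) :
    Real.logb 2 (1 + r ^ 2) * (1 - (1 - p) ^ K) ≤
      ∫ ω, bestUserRate β c K (θ ω) (fun k => X k ω) ∂P := by
  set T : Set Ω := {ω | Real.logb 2 (1 + r ^ 2) ≤ bestUserRate β c K (θ ω) (fun k => X k ω)}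
    with hT
  have hmarkov := mul_meas_ge_le_integral_of_nonneg
    (ae_of_all _ fun ω => bestUserRate_nonneg β c K (θ ω) fun k => X k ω) hint
    (Real.logb 2 (1 + r ^ 2))
  refine le_trans (mul_le_mul_of_nonneg_left ?_
    (Real.logb_nonneg one_lt_two (by linarith [sq_nonneg r]))) hmarkov
  -- Either the rate is at least log₂(1 + r²), or every user is below `r`.
  have hcover : T ∪ {ω | ∀ k : Fin K, ‖channel β c (θ ω) (X k ω)‖ < r} = Set.univ := by
    refine Set.eq_univ_of_forall fun ω => ?_
    by_cases hω : ∀ k : Fin K, ‖channel β c (θ ω) (X k ω)‖ < r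
    · exact Or.inr hω
    · push Not at hω
      obtain ⟨k, hk⟩ := hω
      refine Or.inl ?_
      have h1 : r ^ 2 ≤ ⨆ k : Fin K, snr β c (θ ω) (X k ω) :=
        le_trans (by unfold snr; gcongr)
          (le_ciSup (f := fun k : Fin K => snr β c (θ ω) (X k ω)) (Set.finite_range _).bddAbove k)
      exact Real.logb_le_logb_of_le one_lt_two (by positivity) (by linarith)
  have h1 := measureReal_union_le (μ := P) T
    {ω | ∀ k : Fin K, ‖channel β c (θ ω) (X k ω)‖ < r}
  rw [hcover, probReal_univ] at h1
  have h2 := measureReal_forall_lt_le h K hp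
  change _ ≤ P.real T
  linarith

theorem bestUserRate_eq_zero (hβ : 0 ≤ β) (hc : c.Nonneg) (hv : scatterVar β c = 0) (K : ℕ)
    (x : Fin N → ℝ) (y : ℕ → UserFading N) : bestUserRate β c K x y = 0 := by
  obtain ⟨h1, h2⟩ := hc.eq_zero_of_scatterVar hv
  have h3 : ∀ k, snr β c x (y k) = 0 := by
    intro k
    have := hc.norm_channel_le hβ x (y k).toTuple
    rw [h1, h2, norm_zero, add_zero] at this
    rw [snr, ← UserFading.ofTuple_toTuple (y k), le_antisymm this (norm_nonneg _)]
    simp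
  simp [bestUserRate, h3]

end

/-! ### Asymptotics of the parameters. -/

section

/-- The square root is 1-Lipschitz on `[1, ∞)`, so a shift of O(log x) inside the root shifts the
square by O(log x). -/
theorem sq_sqrt_add_sub_le {v A x q : ℝ} (hv : 0 ≤ v) (hA : 0 ≤ A) (hx : 1 ≤ x) (hq : x ≤ q) :
    (√(v * q) + A) ^ 2 - (√(v * x) + A) ^ 2 ≤ (v + 2 * A * √v) * (q - x) := by
  have hx0 : 0 ≤ x := zero_le_one.trans hx
  have hq0 : 0 ≤ q := hx0.trans hq
  have h1 : √q - √x ≤ q - x := by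
    have hsx : 1 ≤ √x := Real.one_le_sqrt.2 hx
    have hsq : √x ≤ √q := Real.sqrt_le_sqrt hq
    nlinarith [Real.sq_sqrt hx0, Real.sq_sqrt hq0]
  rw [Real.sqrt_mul hv, Real.sqrt_mul hv]
  have h2 : 0 ≤ 2 * A * √v := by positivity
  nlinarith [Real.sq_sqrt hx0, Real.sq_sqrt hq0, Real.sq_sqrt hv,
    mul_le_mul_of_nonneg_left h1 h2]

/-- The size of the upper bound given by exponential moments of order `1 - 1 / log K`. -/
theorem eventually_upper_parameter {v A : ℝ} (hv : 0 ≤ v) (hA : 0 ≤ A) :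
    ∀ᶠ x : ℝ in atTop,
      (√(v * (Real.log (Real.exp x / (1 - (1 - x⁻¹))) / (1 - x⁻¹))) + A) ^ 2 ≤
        (√(v * x) + A) ^ 2 + (v + 2 * A * √v) * 4 * Real.log x := by
  filter_upwards [eventually_ge_atTop 2, Real.tendsto_log_atTop.eventually_ge_atTop 1] with x h2 hL
  have hx0 : 0 < x := by linarith
  have hlog : Real.log (Real.exp x / (1 - (1 - x⁻¹))) = x + Real.log x := by
    rw [sub_sub_cancel, div_inv_eq_mul, Real.log_mul (Real.exp_ne_zero _) hx0.ne', Real.log_exp]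
  have hq : (x + Real.log x) / (1 - x⁻¹) - x = (x + x * Real.log x) / (x - 1) := by
    have h1 : x - 1 ≠ 0 := by linarith
    have h3 : 1 - x⁻¹ = (x - 1) / x := by field_simp
    rw [h3]
    field_simp
    ring
  have hx1 : 0 < x - 1 := by linarith
  have hq0 : 0 ≤ (x + Real.log x) / (1 - x⁻¹) - x := by
    rw [hq]; positivity
  have hq1 : (x + Real.log x) / (1 - x⁻¹) - x ≤ 4 * Real.log x := by
    rw [hq, div_le_iff₀ hx1]
    nlinarith
  have := sq_sqrt_add_sub_le hv hA (by linarith : 1 ≤ x) (sub_nonneg.1 hq0)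
  rw [hlog]
  have h3 : (v + 2 * A * √v) * ((x + Real.log x) / (1 - x⁻¹) - x) ≤
      (v + 2 * A * √v) * (4 * Real.log x) := by
    gcongr
  linarith

/-- A level `A (1 - ε² / 2) + (s - w)` that is close to `√(v x) + A` and that is exceeded with
probability at least `x / e ^ x`. -/
theorem eventually_lower_parameters {v A : ℝ} (hv : 0 < v) (hA : 0 ≤ A) (N : ℕ) :
    ∃ C, 0 ≤ C ∧ ∀ᶠ x : ℝ in atTop, ∃ ε s w : ℝ, 0 ≤ ε ∧ ε ≤ Real.pi ∧ 0 ≤ w ∧ w ≤ s ∧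
      0 ≤ A * (1 - ε ^ 2 / 2) + (s - w) ∧
      A * (1 - ε ^ 2 / 2) + (s - w) ≤ √(v * x) + A ∧
      (√(v * x) + A) ^ 2 - C * Real.log x ≤ (A * (1 - ε ^ 2 / 2) + (s - w)) ^ 2 ∧
      x ≤ Real.exp x * ((ε / (2 * Real.pi)) ^ (N + 1) *
        (w * ((√(2 * Real.pi * (v / 2)))⁻¹ * Real.exp (-s ^ 2 / (2 * (v / 2)))))) := by
  -- With y = √(v x) + A and r the level, y² - r² ≤ 2y(y - r); the other factors bound y/√x and √x
  -- (y - r)/log x.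
  refine ⟨2 * (√v + A) * (A + 1 + √v * (N + 4)), by positivity, ?_⟩
  set b : ℝ := ((2 * Real.pi) ^ (N + 1))⁻¹ * (√(2 * Real.pi * (v / 2)))⁻¹ with hb
  have hb0 : 0 < b := by have := Real.pi_pos; positivity
  have hlog : ∀ᶠ x : ℝ in atTop, (N + 4) * Real.log x ≤ x / 2 := by
    have h := Real.isLittleO_log_id_atTop.bound (c := 1 / (2 * (N + 4))) (by positivity)
    filter_upwards [h, eventually_ge_atTop 1] with x hx h1
    rw [Real.norm_of_nonneg (Real.log_nonneg h1), id, Real.norm_of_nonneg (by linarith)] at hx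
    calc (N + 4) * Real.log x ≤ (N + 4) * (1 / (2 * (N + 4)) * x) := by gcongr
      _ = x / 2 := by field_simp
  filter_upwards [hlog, eventually_ge_atTop 1, eventually_ge_atTop b⁻¹,
    eventually_ge_atTop (2 / v), Real.tendsto_log_atTop.eventually_ge_atTop 1] with x hm h1 hxb hxv hL
  have hx0 : 0 < x := by linarith
  set m := (N + 4) * Real.log x with hmdef
  have hm0 : 0 ≤ m := by positivity
  have hxm : 0 ≤ x - m := by linarith
  set s := √(v * (x - m)) with hs
  have hs2 : s ^ 2 = v * (x - m) := Real.sq_sqrt (by positivity)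
  have hinv : x⁻¹ ≤ 1 := inv_le_one_of_one_le₀ h1
  have hinv0 : 0 < x⁻¹ := by positivity
  have hws : x⁻¹ ≤ s := by
    refine hinv.trans (Real.one_le_sqrt.2 ?_)
    have : 2 ≤ x * v := (div_le_iff₀ hv).1 hxv
    nlinarith
  have hη : 0 ≤ 1 - x⁻¹ ^ 2 / 2 := by nlinarith
  have hsx : s ≤ √(v * x) := Real.sqrt_le_sqrt (by gcongr; linarith)
  set t := √x with ht
  have ht2 : t ^ 2 = x := Real.sq_sqrt hx0.le
  have ht1 : 1 ≤ t := Real.one_le_sqrt.2 h1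
  have hvx : √(v * x) = √v * t := Real.sqrt_mul hv.le x
  have hsv := Real.sq_sqrt hv.le
  have hsv0 := Real.sqrt_pos.2 hv
  -- With ε = w = 1/x the phases and the window cost x^(N+2), while s² = v (x - (N+4) log x) gains
  -- x^(N+4). The surplus b x² is at least x once x ≥ 1/b.
  refine ⟨x⁻¹, s, x⁻¹, hinv0.le, by linarith [Real.pi_gt_three], hinv0.le, hws, ?_, ?_, ?_, ?_⟩
  · have := mul_nonneg hA hη
    linarith
  · have : A * (1 - x⁻¹ ^ 2 / 2) ≤ A * 1 := by gcongr; linarith [sq_nonneg x⁻¹]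
    linarith
  · set y := √(v * x) + A with hy
    set r := A * (1 - x⁻¹ ^ 2 / 2) + (s - x⁻¹) with hr
    have hgap : t * (√(v * x) - s) ≤ √v * m := by
      have h3 : (√(v * x) - s) * (√v * t) ≤ v * m := by
        have h4 : (√(v * x) - s) * (√(v * x) + s) = v * m := by
          have h5 : √(v * x) ^ 2 = v * x := Real.sq_sqrt (by positivity)
          linear_combination h5 - hs2
        rw [← h4, ← hvx]
        have : 0 ≤ s := Real.sqrt_nonneg _
        exact mul_le_mul_of_nonneg_left (by linarith) (by linarith)
      refine le_of_mul_le_mul_left ?_ hsv0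
      nlinarith
    have htx : t * x⁻¹ ≤ 1 := by
      rw [← div_eq_mul_inv, div_le_one hx0, ← ht2]
      nlinarith
    have hd : t * (y - r) ≤ (A + 1 + √v * (N + 4)) * Real.log x := by
      have h5 : t * (y - r) = A * (t * x⁻¹ * x⁻¹) / 2 + t * x⁻¹ + t * (√(v * x) - s) := by
        rw [hy, hr]; ring
      have h6 : t * x⁻¹ * x⁻¹ ≤ 1 := mul_le_one₀ htx hinv0.le hinv
      have h7 : A * (t * x⁻¹ * x⁻¹) ≤ A * 1 := by gcongr
      have h8 : A + 1 ≤ (A + 1) * Real.log x := le_mul_of_one_le_right (by linarith) hL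
      have h9 : √v * m = √v * (N + 4) * Real.log x := by rw [hmdef]; ring
      nlinarith
    have hyt : y ≤ (√v + A) * t := by
      rw [hy, hvx]
      nlinarith
    have hyr : 0 ≤ y - r := by
      have : A * (1 - x⁻¹ ^ 2 / 2) ≤ A * 1 := by gcongr; linarith [sq_nonneg x⁻¹]
      linarith
    have h10 : y * (y - r) ≤ (√v + A) * ((A + 1 + √v * (N + 4)) * Real.log x) :=
      calc y * (y - r) ≤ (√v + A) * t * (y - r) := by gcongr
        _ = (√v + A) * (t * (y - r)) := by ring
        _ ≤ _ := by gcongr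
    have h11 : r ^ 2 = y ^ 2 - 2 * (y * (y - r)) + (y - r) ^ 2 := by ring
    have h12 := sq_nonneg (y - r)
    rw [h11]
    linarith
  · have hexp : Real.exp x * Real.exp (-s ^ 2 / (2 * (v / 2))) = x ^ (N + 4) := by
      rw [← Real.exp_add, hs2, show x + -(v * (x - m)) / (2 * (v / 2)) = m by field_simp; ring,
        hmdef, show ((N : ℝ) + 4) * Real.log x = ((N + 4 : ℕ) : ℝ) * Real.log x by push_cast; rfl,
        Real.exp_nat_mul, Real.exp_log hx0]
    have heq : Real.exp x * ((x⁻¹ / (2 * Real.pi)) ^ (N + 1) *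
        (x⁻¹ * ((√(2 * Real.pi * (v / 2)))⁻¹ * Real.exp (-s ^ 2 / (2 * (v / 2)))))) =
        b * x ^ 2 := by
      calc _ = b * (x⁻¹ ^ (N + 2) *
            (Real.exp x * Real.exp (-s ^ 2 / (2 * (v / 2))))) := by
            rw [hb, div_pow]; ring
        _ = b * x ^ 2 := by
            rw [hexp, inv_pow, pow_add x N 4, pow_add x N 2]
            field_simp
    rw [heq]
    have : 1 ≤ b * x := by
      rw [← inv_mul_le_iff₀ hb0, mul_one]; exact hxb
    calc x ≤ b * x * x := le_mul_of_one_le_left hx0.le this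
      _ = b * x ^ 2 := by ring

theorem eventually_sq_le_exp (D : ℝ) :
    ∀ᶠ x : ℝ in atTop, (D * x) ^ 2 / Real.exp x ≤ 2 * D ^ 2 := by
  filter_upwards [eventually_ge_atTop 0] with x hx
  rw [div_le_iff₀ (Real.exp_pos x)]
  have := Real.quadratic_le_exp_of_nonneg hx
  have h : x ^ 2 ≤ 2 * Real.exp x := by nlinarith
  calc (D * x) ^ 2 = D ^ 2 * x ^ 2 := by ring
    _ ≤ D ^ 2 * (2 * Real.exp x) := by gcongr
    _ = _ := by ring

/-! ### Error bounds on one sub-carrier. -/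

theorem tendsto_log_natCast : Tendsto (fun K : ℕ => Real.log K) atTop atTop :=
  Real.tendsto_log_atTop.comp tendsto_natCast_atTop_atTop

variable {N : ℕ} {Ω : Type*} [MeasurableSpace Ω] {P : Measure Ω} [IsProbabilityMeasure P]
  {β : ℝ} {c : Subchannel N} {θ : Ω → Fin N → ℝ} {X : ℕ → Ω → UserFading N}

theorem integrable_bestUserRate (hβ : 0 ≤ β) (hc : c.Nonneg)
    (h : IndependentRicianFading P c.κ c.κB θ X) {K : ℕ} (hK : 1 ≤ K) :
    Integrable (fun ω => bestUserRate β c K (θ ω) (fun k => X k ω)) P := by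
  rcases (hc.scatterVar_nonneg β).eq_or_lt with hv | hv
  · simp_rw [bestUserRate_eq_zero hβ hc hv.symm]
    exact integrable_zero _ _ _
  · have hK' : (1 : ℝ) ≤ K := by exact_mod_cast hK
    -- Any order in (0, 1) independent of K would do; here log(2K) > 0 even for K = 1.
    refine (integral_bestUserRate_le hβ hc hv h hK (l := 1 / 2) (by norm_num) (by norm_num)
      (Real.log_pos ?_)).1
    norm_num
    linarith

theorem eventually_rate_le (hβ : 0 ≤ β) (hc : c.Nonneg) (hv : 0 < scatterVar β c)
    (h : IndependentRicianFading P c.κ c.κB θ X) :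
    ∃ C, 0 ≤ C ∧ ∀ᶠ K : ℕ in atTop,
      (2 : ℝ) ^ (∫ ω, bestUserRate β c K (θ ω) (fun k => X k ω) ∂P) - 1 - ξ β c K ≤
        C * Real.log (Real.log K) := by
  have hA := losGain_nonneg hβ c
  refine ⟨(scatterVar β c + 2 * losGain β c * √(scatterVar β c)) * 4, by positivity, ?_⟩
  filter_upwards [tendsto_log_natCast.eventually (eventually_upper_parameter hv.le hA),
    tendsto_log_natCast.eventually_ge_atTop 2, eventually_ge_atTop 1] with K hup h2 hK
  have hK0 : (0 : ℝ) < K := by exact_mod_cast hK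
  have hx0 : 0 < Real.log K := by linarith
  have hinv : (Real.log K)⁻¹ < 1 := inv_lt_one_of_one_lt₀ (by linarith)
  rw [Real.exp_log hK0] at hup
  have hpos : 0 < Real.log (K / (1 - (1 - (Real.log K)⁻¹))) := by
    rw [sub_sub_cancel, div_inv_eq_mul, Real.log_mul hK0.ne' hx0.ne']
    have := Real.log_pos (by linarith : 1 < Real.log K)
    positivity
  have hle := (integral_bestUserRate_le hβ hc hv h hK (sub_pos.2 hinv)
    (by linarith [inv_pos.2 hx0]) hpos).2
  have h3 := Real.rpow_le_rpow_of_exponent_le one_le_two hle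
  rw [Real.rpow_logb two_pos (by norm_num) (by positivity)] at h3
  rw [ξ_eq]
  linarith

theorem eventually_le_rate (hβ : 0 ≤ β) (hc : c.Nonneg) (hv : 0 < scatterVar β c)
    (h : IndependentRicianFading P c.κ c.κB θ X) :
    ∃ C, 0 ≤ C ∧ ∀ᶠ K : ℕ in atTop, -(C * Real.log (Real.log K)) ≤
      (2 : ℝ) ^ (∫ ω, bestUserRate β c K (θ ω) (fun k => X k ω) ∂P) - 1 - ξ β c K := by
  have hA := losGain_nonneg hβ c
  obtain ⟨C, hC, hlow⟩ := eventually_lower_parameters hv hA N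
  set v := scatterVar β c
  set A := losGain β c
  set D := 1 + (√v + A) ^ 2 with hD
  refine ⟨C + 2 * D ^ 2, by positivity, ?_⟩
  filter_upwards [tendsto_log_natCast.eventually hlow,
    tendsto_log_natCast.eventually (eventually_sq_le_exp D),
    tendsto_log_natCast.eventually_ge_atTop 1,
    (Real.tendsto_log_atTop.comp tendsto_log_natCast).eventually_ge_atTop 1,
    eventually_ge_atTop 1] with K hlow hsq hx hL hK
  simp only [Function.comp] at hL
  have hK0 : (0 : ℝ) < K := by exact_mod_cast hK
  rw [Real.exp_log hK0] at hlow hsq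
  obtain ⟨ε, s, w, hε, hε', hw, hws, hr0, hr1, hr2, hp⟩ := hlow
  set r := A * (1 - ε ^ 2 / 2) + (s - w)
  set x := Real.log K
  set p := (ε / (2 * Real.pi)) ^ (N + 1) *
        (w * ((√(2 * Real.pi * (v / 2)))⁻¹ * Real.exp (-s ^ 2 / (2 * (v / 2)))))
  have hpr : ∀ y, p ≤ (userLaw N c.κ c.κB).real
      {t | r ≤ ‖channel β c y (UserFading.ofTuple t)‖} := by
    intro y
    refine le_trans ?_ (le_userLaw_norm_channel hc hβ y hε hε')
    have := le_measure_gaussianReal (half_pos hv) hw hws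
    have hpi := Real.pi_pos
    exact mul_le_mul_of_nonneg_left this (by positivity)
  have hlb := le_integral_bestUserRate h (integrable_bestUserRate hβ hc h hK) hr0 hpr
  set J := ∫ ω, bestUserRate β c K (θ ω) (fun k => X k ω) ∂P
  have hp1 : 0 ≤ 1 - p := sub_nonneg.2 ((hpr 0).trans measureReal_le_one)
  -- The parameters were chosen so that K p ≥ log K.
  have hpow : (1 - p) ^ K ≤ 1 / K := by
    calc (1 - p) ^ K ≤ Real.exp (-p) ^ K := by
          gcongr
          exact Real.one_sub_le_exp_neg p
      _ = Real.exp (-(K * p)) := by rw [← Real.exp_nat_mul]; ring_nf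
      _ ≤ Real.exp (-x) := by gcongr
      _ = 1 / K := by rw [Real.exp_neg, Real.exp_log hK0, one_div]
  have hu0 : 0 < 1 + r ^ 2 := by positivity
  have hlogu : Real.log (1 + r ^ 2) ≤ 1 + r ^ 2 :=
    (Real.log_le_sub_one_of_pos hu0).trans (by linarith)
  have hlogu0 : 0 ≤ Real.log (1 + r ^ 2) := Real.log_nonneg (by linarith [sq_nonneg r])
  have hJ : Real.log (1 + r ^ 2) + -(Real.log (1 + r ^ 2) / K) ≤ Real.log 2 * J := by
    have h2 : 0 < Real.log 2 := Real.log_pos one_lt_two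
    calc Real.log (1 + r ^ 2) + -(Real.log (1 + r ^ 2) / K)
        = Real.log (1 + r ^ 2) * (1 - 1 / K) := by ring
      _ ≤ Real.log (1 + r ^ 2) * (1 - (1 - p) ^ K) := by gcongr
      _ = Real.log 2 * (Real.logb 2 (1 + r ^ 2) * (1 - (1 - p) ^ K)) := by
          rw [Real.logb]; field_simp
      _ ≤ _ := by gcongr
  -- The factor 1 - 1/K in the exponent costs at most (1 + r²)²/K, which is bounded because r² =
  -- O(log K).
  have hmain : 1 + r ^ 2 - (1 + r ^ 2) ^ 2 / K ≤ (2 : ℝ) ^ J := by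
    rw [Real.rpow_def_of_pos two_pos]
    refine le_trans ?_ (Real.exp_le_exp.2 hJ)
    rw [Real.exp_add, Real.exp_log hu0]
    have h3 := Real.one_sub_le_exp_neg (Real.log (1 + r ^ 2) / K)
    have h4 : Real.log (1 + r ^ 2) / K ≤ (1 + r ^ 2) / K := by gcongr
    calc 1 + r ^ 2 - (1 + r ^ 2) ^ 2 / K = (1 + r ^ 2) * (1 - (1 + r ^ 2) / K) := by ring
      _ ≤ _ := by
        gcongr
        linarith
  have hu : 1 + r ^ 2 ≤ D * x := by
    have h5 : √(v * x) + A ≤ (√v + A) * √x := by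
      have := Real.one_le_sqrt.2 hx
      rw [Real.sqrt_mul hv.le]
      nlinarith
    have h6 : r ^ 2 ≤ ((√v + A) * √x) ^ 2 := pow_le_pow_left₀ hr0 (hr1.trans h5) 2
    rw [mul_pow, Real.sq_sqrt (by linarith)] at h6
    rw [hD]
    linarith
  have hu2 : (1 + r ^ 2) ^ 2 / K ≤ 2 * D ^ 2 := by
    refine le_trans ?_ hsq
    gcongr
  have h7 : 2 * D ^ 2 ≤ 2 * D ^ 2 * Real.log x := le_mul_of_one_le_right (by positivity) hL
  rw [ξ_eq]
  change _ ≤ _ - 1 - (√(v * x) + A) ^ 2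
  linarith

/-- The mean rate of one sub-channel in the form `log₂ (1 + ξ + e)` with `e = O(log log K)`. -/
theorem isBigO_rate_error (hβ : 0 ≤ β) (hc : c.Nonneg)
    (h : IndependentRicianFading P c.κ c.κB θ X) :
    (fun K : ℕ => (2 : ℝ) ^ (∫ ω, bestUserRate β c K (θ ω) (fun k => X k ω) ∂P) - 1 - ξ β c K)
      =O[atTop] fun K : ℕ => Real.log (Real.log K) := by
  rcases (hc.scatterVar_nonneg β).eq_or_lt with hv | hv
  · have h0 : ∀ K, ξ β c K = 0 := fun K => by
      rw [ξ_eq, ← hv, (hc.eq_zero_of_scatterVar hv.symm).1]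
      simp
    simp_rw [bestUserRate_eq_zero hβ hc hv.symm, h0]
    simpa using isBigO_zero _ _
  · obtain ⟨C₁, hC₁, h₁⟩ := eventually_rate_le hβ hc hv h
    obtain ⟨C₂, hC₂, h₂⟩ := eventually_le_rate hβ hc hv h
    refine IsBigO.of_bound (C₁ + C₂) ?_
    filter_upwards [h₁, h₂,
      (Real.tendsto_log_atTop.comp tendsto_log_natCast).eventually_ge_atTop 0] with K h₁ h₂ hL
    simp only [Function.comp] at hL
    rw [Real.norm_of_nonneg hL, Real.norm_eq_abs, abs_le]
    constructor <;> nlinarith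

end

end RSOBF

end

/-! ### Summation over the sub-carriers. -/

theorem corollary6 {Ω : Type*} [MeasurableSpace Ω] (P : Measure Ω) [IsProbabilityMeasure P]
    {L N : ℕ} (β : ℝ) (hβ : 0 ≤ β) (c : Fin L → RSOBF.Subchannel N)
    (hρR : ∀ l, 0 ≤ (c l).ρR) (hρB : ∀ l, 0 ≤ (c l).ρB)
    (hκ : ∀ l, 0 ≤ (c l).κ) (hκB : ∀ l, 0 ≤ (c l).κB)
    (θ : Ω → Fin N → ℝ) (X : Fin L → ℕ → Ω → RSOBF.UserFading N)
    (hX : ∀ l, RSOBF.IndependentRicianFading P (c l).κ (c l).κB θ (X l)) :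
    (∀ K : ℕ, 1 ≤ K → ∀ l,
      Integrable (fun ω => RSOBF.bestUserRate β (c l) K (θ ω) (fun k => X l k ω)) P) ∧
    ∃ e : Fin L → ℕ → ℝ,
      (∀ l, e l =O[atTop] fun K : ℕ => Real.log (Real.log K)) ∧
      ∀ K : ℕ, 1 ≤ K →
        (∀ l, 0 < 1 + RSOBF.ξ β (c l) K + e l K) ∧
        RSOBF.sumCapacity P β c θ X K =
          ∑ l, Real.logb 2 (1 + RSOBF.ξ β (c l) K + e l K) := by
  have hc : ∀ l, (c l).Nonneg := fun l => ⟨hρR l, hρB l, hκ l, hκB l⟩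
  have hint : ∀ K : ℕ, 1 ≤ K → ∀ l,
      Integrable (fun ω => RSOBF.bestUserRate β (c l) K (θ ω) (fun k => X l k ω)) P :=
    fun K hK l => RSOBF.integrable_bestUserRate hβ (hc l) (hX l) hK
  refine ⟨hint, fun l K => (2 : ℝ) ^ (∫ ω, RSOBF.bestUserRate β (c l) K (θ ω)
    (fun k => X l k ω) ∂P) - 1 - RSOBF.ξ β (c l) K,
    fun l => RSOBF.isBigO_rate_error hβ (hc l) (hX l), fun K hK => ?_⟩
  have heq : ∀ l, 1 + RSOBF.ξ β (c l) K + ((2 : ℝ) ^ (∫ ω, RSOBF.bestUserRate β (c l) K (θ ω)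
      (fun k => X l k ω) ∂P) - 1 - RSOBF.ξ β (c l) K) =
      (2 : ℝ) ^ (∫ ω, RSOBF.bestUserRate β (c l) K (θ ω) (fun k => X l k ω) ∂P) :=
    fun l => by ring
  simp_rw [heq]
  refine ⟨fun l => by positivity, ?_⟩
  rw [RSOBF.sumCapacity, integral_finsetSum _ fun l _ => hint K hK l]
  exact Finset.sum_congr rfl fun l _ => (Real.logb_rpow two_pos (by norm_num)).symm
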